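/- Let $1\le M\le N$ be integers (numbers of transmit and receive antennas). A vector $x=(x_1,\dots,x_M)$ of Gaussian integers is sent, where $x_1,\dots,x_M$ are independent and $x_j$ takes its values in a constellation $\mathcal A_j\subseteq\mathbb Z[i]$ (finite or not), with a fixed distribution on it. With a fixed amplitude scaling $\kappa>0$ (for instance the one with $\mathbb E\|\kappa x\|^2=1$), the receiver observes $$y=\kappa Hx+w ,$$ where the entries of the $N\times M$ matrix $H$ are i.i.d. circularly symmetric complex Gaussian with mean $0$ and variance $1$, the entries of the noise $w\in\mathbb C^N$ are i.i.d. circularly symmetric complex Gaussian with mean $0$ and variance $1/\rho$ ($\rho>0$ is the signal-to-noise ratio), and $H$, $w$, $x$ are independent. The law of $x$ and $\kappa$ do not depend on $\rho$. Naive lattice decoding: the receiver, which knows $H$, finds $\hat x\in\mathbb Z[i]^M$ that minimizes $\|y-\kappa H\hat x\|$ over all of $\mathbb Z[i]^M$ (a minimizer exists almost surely; ties are broken arbitrarily); it outputs $\hat x$ if $\hat x\in\mathcal A_1\times\dots\times\mathcal A_M$, and otherwise it discards $\hat x$, which counts as an error. Let $P_e(\rho)$ be the probability that the output is not the transmitted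 vector $x$. Then naive lattice decoding has diversity exactly $N$: $$\lim_{\rho\to\infty}\frac{-\log P_e(\rho)}{\log\rho}=N .$$ -/

import Mathlib

open Filter Topology MeasureTheory ProbabilityTheory

noncomputable section

/-- The countable set of Gaussian integers carries the discrete sigma-algebra. -/
instance GaussianInt.instMeasurableSpaceDiscrete : MeasurableSpace GaussianInt := ⊤

/-- The zero-mean circularly symmetric complex Gaussian distribution of variance `v`
(`E |z| ^ 2 = v`): independent real and imaginary parts, each of variance `v / 2`. -/
def complexGaussian (v : NNReal) : Measure ℂ :=
  ((gaussianReal 0 (v / 2)).prod (gaussianReal 0 (v / 2))).map fun t : ℝ × ℝ => (⟨t.1, t.2⟩ : ℂ)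

/-- Law of the `N × M` Rayleigh channel matrix: i.i.d. complex Gaussian entries
of zero mean and unit variance. -/
def channelLaw (N M : ℕ) : Measure (Fin N → Fin M → ℂ) :=
  Measure.pi fun _ => Measure.pi fun _ => complexGaussian 1

/-- Law of the noise at signal to noise ratio `ρ`: i.i.d. complex Gaussian entries of zero mean
and variance `σ ^ 2 = 1 / ρ`. -/
def noiseLaw (N : ℕ) (ρ : ℝ) : Measure (Fin N → ℂ) :=
  Measure.pi fun _ => complexGaussian (1 / ρ).toNNReal

/-- Law of the transmitted vector of Gaussian integers: the entries are independent and the one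
sent by antenna (or user) `j` has distribution `p j`. -/
def inputLaw {M : ℕ} (p : Fin M → PMF GaussianInt) : Measure (Fin M → GaussianInt) :=
  Measure.pi fun j => (p j).toMeasure

/-- The noiseless received vector `H (κ x)`: the integer vector `x` is sent with amplitude
scaling `κ`. -/
def latticePoint {N M : ℕ} (κ : ℝ) (H : Fin N → Fin M → ℂ) (x : Fin M → GaussianInt) :
    Fin N → ℂ :=
  (Matrix.of H).mulVec fun j => (κ : ℂ) * GaussianInt.toComplex (x j)

/-- `H (κ z)` is a point of the lattice `{H (κ z') : z' ∈ ℤ[i] ^ M}` at minimal Euclidean distance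
from `y`. -/
def IsNearestLatticePoint {N M : ℕ} (κ : ℝ) (H : Fin N → Fin M → ℂ) (y : Fin N → ℂ)
    (z : Fin M → GaussianInt) : Prop :=
  ∀ z' : Fin M → GaussianInt,
    ‖WithLp.toLp 2 (y - latticePoint κ H z)‖ ≤ ‖WithLp.toLp 2 (y - latticePoint κ H z')‖

/-- `D` is a lattice decoder: from the channel matrix and the received vector it finds a nearest
point of the whole (infinite) lattice, whenever there is one. Ties are broken in any way. -/
def IsLatticeDecoder {N M : ℕ} (κ : ℝ)
    (D : (Fin N → Fin M → ℂ) → (Fin N → ℂ) → (Fin M → GaussianInt)) : Prop :=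
  ∀ (H : Fin N → Fin M → ℂ) (y : Fin N → ℂ),
    (∃ z, IsNearestLatticePoint κ H y z) → IsNearestLatticePoint κ H y (D H y)

open Classical in
/-- Output of naive lattice decoding for the constellations `A j`: the point found by the lattice
decoder if it lies in the region `∏ A j`, and a decoding failure `none` otherwise. -/
def naiveOutput {N M : ℕ} (A : Fin M → Set GaussianInt)
    (D : (Fin N → Fin M → ℂ) → (Fin N → ℂ) → (Fin M → GaussianInt))
    (H : Fin N → Fin M → ℂ) (y : Fin N → ℂ) : Option (Fin M → GaussianInt) :=
  if ∀ j, D H y j ∈ A j then some (D H y) else none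

/-- Error probability of naive lattice decoding at signal to noise ratio `ρ`. The channel matrix
`H`, the noise `w` and the transmitted vector `x` are independent, and `y = H (κ x) + w`. -/
def naiveErrorProb {N M : ℕ} (κ : ℝ) (A : Fin M → Set GaussianInt) (p : Fin M → PMF GaussianInt)
    (D : (Fin N → Fin M → ℂ) → (Fin N → ℂ) → (Fin M → GaussianInt)) (ρ : ℝ) : ℝ :=
  ((channelLaw N M).prod ((noiseLaw N ρ).prod (inputLaw p))).real
    {s : (Fin N → Fin M → ℂ) × (Fin N → ℂ) × (Fin M → GaussianInt) |
      naiveOutput A D s.1 (latticePoint κ s.1 s.2.2 + s.2.1) ≠ some s.2.2}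

end

/-!
An error of the lattice decoder means that, for some nonzero Gaussian integer vector `u`, the lattice
point `κ H u` is at least as close to the noise `w` as the origin is.

Lower bound (`exists_le_naiveErrorProb`). With probability of order `ρ ^ (-N)` the `N` entries of the
first column of `H` are all of size `1 / √ρ`, that is, of the size of the noise. In that case, with a
probability that stays away from zero, the noise is closer to this column (times `κ`) than to the
origin, while the matrix is still of full column rank, so that the decoder does find a nearest point,
a wrong one.

Upper bound (`exists_naiveErrorProb_le`). For a fixed `u`, each of the `N` independent coordinates of
`κ H u` has to fall into a disc of radius `‖w‖`, which gives a pairwise error probability of at most a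
constant times `ρ ^ (-N) ‖u‖ ^ (-2 N)` (`exists_pairwise_le`). The sum of these bounds over
`ℤ[i] ^ M`, a lattice of rank `2 M`, diverges when `M = N`, but only logarithmically; over the
vectors with `‖u‖ ≤ R` it costs at most a factor of order `R ^ η`, for any `η > 0`
(`exists_sum_pairwise_le`). A polynomial `R` in `ρ` is enough: a longer `u` with `‖κ H u‖ ≤ 2 ‖w‖`
forces, by Cramer's rule (`norm_apply_le_of_leadingMinor`), a large entry of `H`, a large noise vector,
or a leading `M × M` minor of `H` below a power of `1 / ρ`. The first two have probability
`O(ρ ^ (-N))` by Markov's inequality. So has the third for a suitable power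
(`channelLaw_leadingMinor_le`): given the other entries, each leading minor is an affine function of
its last diagonal entry, with the preceding leading minor as slope, so that small minors are unlikely
by induction on their size.

As `δ > 0` is arbitrary in the upper bound `O(ρ ^ (-N + δ))`, the exponent is exactly `N`
(`tendsto_neg_log_div_log`).
-/

/-! ### The complex Gaussian law -/

theorem measurable_complex_mk : Measurable fun t : ℝ × ℝ => (⟨t.1, t.2⟩ : ℂ) :=
  Complex.measurableEquivRealProd.symm.measurable

instance complexGaussian.instIsProbabilityMeasure (v : NNReal) :
    IsProbabilityMeasure (complexGaussian v) :=
  Measure.isProbabilityMeasure_map measurable_complex_mk.aemeasurable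

/-- The density of a real Gaussian variable of variance `1 / 2` is at most `1 / √π ≤ 1`. -/
theorem gaussianReal_half_le_volume (S : Set ℝ) : gaussianReal 0 (1 / 2) S ≤ volume S := by
  rw [gaussianReal_apply _ (by norm_num)]
  calc ∫⁻ x in S, gaussianPDF 0 (1 / 2) x ≤ ∫⁻ _ in S, 1 := by
        refine lintegral_mono fun x => ?_
        rw [gaussianPDF, gaussianPDFReal, ENNReal.ofReal_le_one]
        have h1 : (1 : ℝ) ≤ √(2 * Real.pi * ((1 / 2 : NNReal) : ℝ)) := by
          rw [Real.one_le_sqrt]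
          push_cast
          linarith [Real.pi_gt_three]
        refine mul_le_one₀ (inv_le_one_of_one_le₀ h1) (Real.exp_nonneg _) ?_
        rw [Real.exp_le_one_iff]
        exact div_nonpos_of_nonpos_of_nonneg (by nlinarith [sq_nonneg (x - 0)]) (by positivity)
    _ = volume S := by simp

theorem complexGaussian_closedBall_le (c : ℂ) (r : ℝ) :
    complexGaussian 1 {x | ‖x - c‖ ≤ r} ≤ ENNReal.ofReal (4 * r ^ 2) := by
  rcases lt_or_ge r 0 with hr | hr
  · have : {x : ℂ | ‖x - c‖ ≤ r} = ∅ := by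
      ext x
      simpa using hr.trans_le (norm_nonneg _)
    simp [this]
  have hm : MeasurableSet {x : ℂ | ‖x - c‖ ≤ r} := measurableSet_le (by fun_prop) (by fun_prop)
  rw [complexGaussian, Measure.map_apply measurable_complex_mk hm]
  calc _ ≤ ((gaussianReal 0 (1 / 2)).prod (gaussianReal 0 (1 / 2)))
        (Set.Icc (c.re - r) (c.re + r) ×ˢ Set.Icc (c.im - r) (c.im + r)) := by
        refine measure_mono fun t ht => ?_
        have h1 := (Complex.abs_re_le_norm _).trans (show ‖(⟨t.1, t.2⟩ : ℂ) - c‖ ≤ r from ht)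
        have h2 := (Complex.abs_im_le_norm _).trans (show ‖(⟨t.1, t.2⟩ : ℂ) - c‖ ≤ r from ht)
        simp only [Complex.sub_re, Complex.sub_im, abs_le] at h1 h2
        refine ⟨⟨?_, ?_⟩, ⟨?_, ?_⟩⟩ <;> linarith
    _ ≤ ENNReal.ofReal (2 * r) * ENNReal.ofReal (2 * r) := by
        rw [Measure.prod_prod]
        gcongr <;> refine (gaussianReal_half_le_volume _).trans (le_of_eq ?_) <;>
          rw [Real.volume_Icc] <;> ring_nf
    _ = ENNReal.ofReal (4 * r ^ 2) := by
        rw [← ENNReal.ofReal_mul (by positivity)]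
        ring_nf

/-- Small balls are charged uniformly little by every nondegenerate affine image of a complex
Gaussian variable. -/
theorem complexGaussian_affine_le {a : ℂ} (ha : a ≠ 0) (b : ℂ) (r : ℝ) :
    complexGaussian 1 {x | ‖x * a + b‖ ≤ r} ≤ ENNReal.ofReal (4 * (r / ‖a‖) ^ 2) := by
  have : {x : ℂ | ‖x * a + b‖ ≤ r} = {x | ‖x - -(b / a)‖ ≤ r / ‖a‖} := by
    ext x
    rw [Set.mem_ofPred_eq, Set.mem_ofPred_eq, le_div_iff₀ (norm_pos_iff.2 ha), ← norm_mul]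
    congr! 2
    field_simp
    ring
  rw [this]
  exact complexGaussian_closedBall_le _ _

theorem le_gaussianReal_half_Icc {B a b : ℝ} (ha : -B ≤ a) (hb : b ≤ B) :
    ENNReal.ofReal (gaussianPDFReal 0 (1 / 2) B * (b - a)) ≤
      gaussianReal 0 (1 / 2) (Set.Icc a b) := by
  rw [gaussianReal_apply _ (by norm_num), ENNReal.ofReal_mul (gaussianPDFReal_nonneg _ _ _)]
  calc _ = ∫⁻ _ in Set.Icc a b, ENNReal.ofReal (gaussianPDFReal 0 (1 / 2) B) := by simp
    _ ≤ _ := by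
        refine setLIntegral_mono (by fun_prop) fun x hx => ?_
        rw [gaussianPDF]
        refine ENNReal.ofReal_le_ofReal ?_
        unfold gaussianPDFReal
        have : (x - 0) ^ 2 ≤ (B - 0) ^ 2 := by
          rw [sub_zero, sub_zero]
          exact sq_le_sq' (ha.trans hx.1) (hx.2.trans hb)
        gcongr

/-- A dilated complex Gaussian variable `s x` hits a given ball with probability at least of
order `s⁻²`. -/
theorem exists_le_complexGaussian_ball (c : ℂ) {ε : ℝ} (hε : 0 < ε) :
    ∃ k : ℝ, 0 < k ∧ ∀ s : ℝ, 1 ≤ s →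
      ENNReal.ofReal (k / s ^ 2) ≤ complexGaussian 1 {x | ‖(s : ℂ) * x - c‖ < ε} := by
  set B := ‖c‖ + ε with hB
  set k := gaussianPDFReal 0 (1 / 2) B with hk
  have hk0 : 0 < k := gaussianPDFReal_pos _ _ _ (by norm_num)
  refine ⟨(k * (ε / 2)) ^ 2, by positivity, fun s hs => ?_⟩
  have hs0 : 0 < s := by linarith
  have hm : MeasurableSet {x : ℂ | ‖(s : ℂ) * x - c‖ < ε} :=
    measurableSet_lt (by fun_prop) (by fun_prop)
  have key : ∀ t : ℝ, |t| ≤ ‖c‖ → ENNReal.ofReal (k * (ε / 2) / s) ≤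
      gaussianReal 0 (1 / 2) (Set.Icc ((t - ε / 4) / s) ((t + ε / 4) / s)) := by
    intro t ht
    rw [abs_le] at ht
    have hB0 : 0 ≤ B := by positivity
    refine le_trans (le_of_eq ?_) (le_gaussianReal_half_Icc (B := B) ?_ ?_)
    · congr 1
      field_simp
      ring
    · rw [le_div_iff₀ hs0]
      nlinarith
    · rw [div_le_iff₀ hs0]
      nlinarith
  rw [complexGaussian, Measure.map_apply measurable_complex_mk hm]
  calc ENNReal.ofReal ((k * (ε / 2)) ^ 2 / s ^ 2)
      = ENNReal.ofReal (k * (ε / 2) / s) * ENNReal.ofReal (k * (ε / 2) / s) := by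
        rw [← ENNReal.ofReal_mul (by positivity)]
        ring_nf
    _ ≤ ((gaussianReal 0 (1 / 2)).prod (gaussianReal 0 (1 / 2)))
        (Set.Icc ((c.re - ε / 4) / s) ((c.re + ε / 4) / s) ×ˢ
          Set.Icc ((c.im - ε / 4) / s) ((c.im + ε / 4) / s)) := by
        rw [Measure.prod_prod]
        exact mul_le_mul' (key _ (Complex.abs_re_le_norm c)) (key _ (Complex.abs_im_le_norm c))
    _ ≤ _ := by
        refine measure_mono fun t ht => ?_
        obtain ⟨⟨h1, h2⟩, h3, h4⟩ := ht
        rw [div_le_iff₀ hs0] at h1 h3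
        rw [le_div_iff₀ hs0] at h2 h4
        refine (Complex.norm_le_abs_re_add_abs_im _).trans_lt ?_
        have e1 : |((s : ℂ) * ⟨t.1, t.2⟩ - c).re| ≤ ε / 4 := by
          simp only [Complex.sub_re, Complex.re_ofReal_mul]
          exact abs_le.2 ⟨by linarith, by linarith⟩
        have e2 : |((s : ℂ) * ⟨t.1, t.2⟩ - c).im| ≤ ε / 4 := by
          simp only [Complex.sub_im, Complex.im_ofReal_mul]
          exact abs_le.2 ⟨by linarith, by linarith⟩
        linarith

theorem complexGaussian_eq_map (v : NNReal) :
    complexGaussian v = (complexGaussian 1).map fun x => ((√v : ℝ) : ℂ) * x := by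
  have h : gaussianReal 0 (v / 2) = (gaussianReal 0 (1 / 2)).map (fun x => √v * x) := by
    rw [gaussianReal_map_const_mul, mul_zero]
    congr 1
    ext
    simp [div_eq_mul_inv]
  rw [complexGaussian, h, complexGaussian, Measure.map_prod_map _ _ (by fun_prop) (by fun_prop),
    Measure.map_map measurable_complex_mk (by fun_prop),
    Measure.map_map (by fun_prop) measurable_complex_mk]
  congr 1
  ext t
  apply Complex.ext <;> simp

theorem memLp_id_complexGaussian (p : ENNReal) (hp : p ≠ ⊤) :
    MemLp id p (complexGaussian 1) := by
  have h : complexGaussian 1 = ((gaussianReal 0 (1 / 2)).prod (gaussianReal 0 (1 / 2))).map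
      (Complex.equivRealProdCLM.symm : ℝ × ℝ →L[ℝ] ℂ) := by
    rw [complexGaussian]
    congr 1
  rw [h]
  exact IsGaussian.memLp_id _ p hp

/-! ### The channel, noise and input laws -/

instance (N M : ℕ) : IsProbabilityMeasure (channelLaw N M) := by
  unfold channelLaw; infer_instance

instance (N : ℕ) (ρ : ℝ) : IsProbabilityMeasure (noiseLaw N ρ) := by
  unfold noiseLaw; infer_instance

instance {M : ℕ} (p : Fin M → PMF GaussianInt) : IsProbabilityMeasure (inputLaw p) := by
  unfold inputLaw
  have := fun j => PMF.toMeasure.isProbabilityMeasure (p j)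
  infer_instance

theorem noiseLaw_eq_map (N : ℕ) {ρ : ℝ} (hρ : 0 < ρ) :
    noiseLaw N ρ = (noiseLaw N 1).map fun w i => (((√ρ)⁻¹ : ℝ) : ℂ) * w i := by
  have h1 : ((1 : ℝ) / 1).toNNReal = 1 := by simp
  have h2 : √(((1 / ρ).toNNReal : NNReal) : ℝ) = (√ρ)⁻¹ := by
    rw [Real.coe_toNNReal _ (by positivity), one_div, Real.sqrt_inv]
  rw [noiseLaw, noiseLaw, h1, Measure.pi_map_pi (fun _ => by fun_prop)]
  congr 1
  ext1 i
  rw [complexGaussian_eq_map, h2]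

/-- The `n`-th moment of the noise is at most of order `ρ ^ (-n / 2)`. -/
theorem lintegral_norm_pow_noiseLaw (N n : ℕ) : ∃ C : ℝ, 0 ≤ C ∧ ∀ ρ : ℝ, 0 < ρ →
    ∫⁻ w, ENNReal.ofReal (‖WithLp.toLp 2 w‖ ^ n) ∂(noiseLaw N ρ) ≤
      ENNReal.ofReal (C * (√ρ)⁻¹ ^ n) := by
  have hint : Integrable (fun w : Fin N → ℂ => ‖WithLp.toLp 2 w‖ ^ n) (noiseLaw N 1) := by
    have hL : MemLp (fun w : Fin N → ℂ => ‖WithLp.toLp 2 w‖) n (noiseLaw N 1) := by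
      have hs : MemLp (fun w : Fin N → ℂ => ∑ i, ‖w i‖) n (noiseLaw N 1) := by
        refine memLp_finsetSum _ fun i _ => ?_
        have h := memLp_id_complexGaussian n (by simp)
        have hmp := measurePreserving_eval (fun _ : Fin N => complexGaussian 1) i
        have := (h.comp_measurePreserving hmp).norm
        simpa [noiseLaw, Function.comp_def] using this
      refine hs.mono (by fun_prop) (ae_of_all _ fun w => ?_)
      rw [norm_norm]
      refine le_trans ?_ (Real.le_norm_self _)
      rw [EuclideanSpace.norm_eq]
      refine Real.sqrt_le_iff.2 ⟨by positivity, ?_⟩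
      exact Finset.sum_sq_le_sq_sum_of_nonneg fun i _ => norm_nonneg _
    rcases Nat.eq_zero_or_pos n with rfl | hn
    · simp
    simpa using hL.integrable_norm_pow (by omega)
  refine ⟨∫ w, ‖WithLp.toLp 2 w‖ ^ n ∂(noiseLaw N 1), integral_nonneg fun _ => by positivity,
    fun ρ hρ => ?_⟩
  have hr : 0 ≤ (√ρ)⁻¹ := by positivity
  rw [noiseLaw_eq_map N hρ, lintegral_map (by fun_prop) (by fun_prop)]
  have : ∀ w : Fin N → ℂ, ENNReal.ofReal (‖WithLp.toLp 2 fun i => (((√ρ)⁻¹ : ℝ) : ℂ) * w i‖ ^ n) =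
      ENNReal.ofReal ((√ρ)⁻¹ ^ n) * ENNReal.ofReal (‖WithLp.toLp 2 w‖ ^ n) := by
    intro w
    have h : (WithLp.toLp 2 fun i => (((√ρ)⁻¹ : ℝ) : ℂ) * w i) =
        (((√ρ)⁻¹ : ℝ) : ℂ) • WithLp.toLp 2 w := rfl
    rw [h, norm_smul, Complex.norm_real, Real.norm_of_nonneg hr, mul_pow,
      ENNReal.ofReal_mul (by positivity)]
  simp_rw [this]
  rw [lintegral_const_mul _ (by fun_prop), mul_comm, ← ofReal_integral_eq_lintegral_ofReal hint
    (ae_of_all _ fun _ => by positivity),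
    ← ENNReal.ofReal_mul (integral_nonneg fun _ => by positivity)]

/-! ### Resampling one coordinate of a product measure -/

/-- A bound on the conditional probability of `S`, given all coordinates but the `i`-th, is a bound
on its probability. -/
theorem pi_le_of_forall_update_le {ι : Type*} [Fintype ι] [DecidableEq ι] {X : ι → Type*}
    [∀ i, MeasurableSpace (X i)] (μ : ∀ i, Measure (X i)) [∀ i, IsProbabilityMeasure (μ i)]
    (i : ι) {S : Set (∀ i, X i)} (hS : MeasurableSet S) {c : ENNReal}
    (h : ∀ ω, μ i {x | Function.update ω i x ∈ S} ≤ c) : Measure.pi μ S ≤ c := by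
  have key : ∫⁻ ω, S.indicator (1 : (∀ i, X i) → ENNReal) ω ∂(Measure.pi μ) ≤
      ∫⁻ _, c ∂(Measure.pi μ) := by
    refine lintegral_le_of_lmarginal_le {i} (measurable_one.indicator hS) measurable_const ?_
    intro ω
    rw [lmarginal_singleton, lmarginal_singleton]
    have hm : MeasurableSet {x | Function.update ω i x ∈ S} := measurable_update ω hS
    have h2 : ∀ x, S.indicator (1 : (∀ i, X i) → ENNReal) (Function.update ω i x) =
        {x | Function.update ω i x ∈ S}.indicator 1 x := fun x => rfl
    simp_rw [h2]
    rw [lintegral_indicator_one hm]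
    simpa using h ω
  rw [lintegral_indicator_one hS] at key
  simpa using key

theorem channelLaw_le_of_forall_update_le {N M : ℕ} (i : Fin N) (j : Fin M)
    {S : Set (Fin N → Fin M → ℂ)} (hS : MeasurableSet S) {c : ENNReal}
    (h : ∀ H : Fin N → Fin M → ℂ,
      complexGaussian 1 {x | Function.update H i (Function.update (H i) j x) ∈ S} ≤ c) :
    channelLaw N M S ≤ c := by
  refine pi_le_of_forall_update_le _ i hS fun H => ?_
  refine pi_le_of_forall_update_le _ j (measurable_update H hS) fun v => ?_
  simpa using h (Function.update H i v)

/-! ### Leading minors of the channel matrix -/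

/-- The leading principal `k × k` minor of an `N × M` array. -/
noncomputable def leadingMinor {N M k : ℕ} (hN : k ≤ N) (hM : k ≤ M) (H : Fin N → Fin M → ℂ) : ℂ :=
  (Matrix.of fun i j : Fin k => H (i.castLE hN) (j.castLE hM)).det

theorem continuous_leadingMinor {N M k : ℕ} (hN : k ≤ N) (hM : k ≤ M) :
    Continuous (leadingMinor hN hM) := by
  unfold leadingMinor
  refine Continuous.matrix_det ?_
  refine continuous_matrix fun i j => ?_
  simp only [Matrix.of_apply]
  fun_prop

theorem det_updateRow_last_update {R : Type*} [CommRing R] {k : ℕ}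
    (A : Matrix (Fin (k + 1)) (Fin (k + 1)) R) (x : R) :
    (A.updateRow (Fin.last k) (Function.update (A (Fin.last k)) (Fin.last k) x)).det =
      x * (A.submatrix Fin.castSucc Fin.castSucc).det +
        (A.updateRow (Fin.last k) (Function.update (A (Fin.last k)) (Fin.last k) 0)).det := by
  have h : Function.update (A (Fin.last k)) (Fin.last k) x =
      x • Pi.single (Fin.last k) 1 + Function.update (A (Fin.last k)) (Fin.last k) 0 := by
    ext j
    by_cases hj : j = Fin.last k
    · subst hj; simp
    · simp [hj]
  -- The slope is the cofactor of the last diagonal entry.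
  have h2 : (A.updateRow (Fin.last k) (Pi.single (Fin.last k) 1)).det =
      (A.submatrix Fin.castSucc Fin.castSucc).det := by
    rw [← Matrix.adjugate_apply, Matrix.adjugate_fin_succ_eq_det_submatrix]
    simp [← two_mul, Fin.succAbove_last]
  rw [h, Matrix.det_updateRow_add, Matrix.det_updateRow_smul, h2]

/-- As a function of the entry `(k, k)`, the `(k + 1)`-st leading minor is affine, and its slope is the
`k`-th leading minor. -/
theorem leadingMinor_succ_update {N M k : ℕ} (hN : k + 1 ≤ N) (hM : k + 1 ≤ M)
    (H : Fin N → Fin M → ℂ) : ∃ b : ℂ, ∀ x : ℂ,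
      leadingMinor hN hM (Function.update H ⟨k, hN⟩ (Function.update (H ⟨k, hN⟩) ⟨k, hM⟩ x)) =
        x * leadingMinor (Nat.le_of_succ_le hN) (Nat.le_of_succ_le hM) H + b := by
  refine ⟨((Matrix.of fun i j : Fin (k + 1) => H (i.castLE hN) (j.castLE hM)).updateRow (Fin.last k)
    (Function.update (fun j => H ⟨k, hN⟩ (j.castLE hM)) (Fin.last k) 0)).det, fun x => ?_⟩
  have key := det_updateRow_last_update
    (Matrix.of fun i j : Fin (k + 1) => H (i.castLE hN) (j.castLE hM)) x
  refine Eq.trans ?_ key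
  unfold leadingMinor
  congr 1
  ext i j
  have hi : (i.castLE hN = ⟨k, hN⟩) ↔ i = Fin.last k := by simp [Fin.ext_iff]
  have hj : (j.castLE hM = ⟨k, hM⟩) ↔ j = Fin.last k := by simp [Fin.ext_iff]
  simp only [Matrix.of_apply, Matrix.updateRow_apply, Function.update_apply]
  by_cases h : i = Fin.last k
  · subst h
    by_cases h' : j = Fin.last k
    · subst h'
      rw [if_pos (hi.2 rfl), if_pos rfl, Function.update_apply, if_pos (hj.2 rfl), if_pos rfl]
    · rw [if_pos (hi.2 rfl), if_pos rfl, Function.update_apply, if_neg (hj.not.2 h'), if_neg h']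
      rfl
  · rw [if_neg (hi.not.2 h), if_neg h]

theorem leadingMinor_update {N M k : ℕ} (hN : k + 1 ≤ N) (hM : k + 1 ≤ M)
    (H : Fin N → Fin M → ℂ) (v : Fin M → ℂ) :
    leadingMinor (Nat.le_of_succ_le hN) (Nat.le_of_succ_le hM) (Function.update H ⟨k, hN⟩ v) =
      leadingMinor (Nat.le_of_succ_le hN) (Nat.le_of_succ_le hM) H := by
  unfold leadingMinor
  congr 1
  ext i j
  have : i.castLE (Nat.le_of_succ_le hN) ≠ ⟨k, hN⟩ := by
    simp [Fin.ext_iff, i.2.ne]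
  simp [this]

/-- Leading minors are rarely small. Given the rest of the matrix, the `(k + 1)`-st leading minor
is an affine function of the entry `(k, k)`, with the `k`-th leading minor as its slope. -/
theorem channelLaw_leadingMinor_le {N M k : ℕ} (hN : k ≤ N) (hM : k ≤ M) {r : ℝ} (hr : 0 < r)
    (hr1 : r ≤ 1) :
    channelLaw N M {H | ‖leadingMinor hN hM H‖ ≤ r ^ 2 ^ k} ≤ ENNReal.ofReal ((4 * k + 1) * r) := by
  induction k with
  | zero =>
    rcases hr1.lt_or_eq with h | rfl
    · simp [leadingMinor, h.not_ge]
    · simpa using prob_le_one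
  | succ k ih =>
    set q := r ^ 2 ^ k with hq
    have hq0 : 0 < q := by positivity
    have hqr : q ≤ r := pow_le_of_le_one hr.le hr1 (by positivity)
    have hN' := Nat.le_of_succ_le hN
    have hM' := Nat.le_of_succ_le hM
    have hpow : r ^ 2 ^ (k + 1) = q ^ 2 := by rw [hq, ← pow_mul, pow_succ]
    -- If the minor of size `k + 1` is at most `q ^ 2`, then either its slope in the last diagonal
    -- entry is at most `q`, or it is small although its slope is more than `q`.
    set S := {H : Fin N → Fin M → ℂ | ‖leadingMinor hN hM H‖ ≤ q ^ 2 ∧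
      q < ‖leadingMinor hN' hM' H‖} with hS
    have hSm : MeasurableSet S :=
      (measurableSet_le (continuous_leadingMinor hN hM).norm.measurable measurable_const).inter
        (measurableSet_lt measurable_const (continuous_leadingMinor hN' hM').norm.measurable)
    have hSle : channelLaw N M S ≤ ENNReal.ofReal (4 * r) := by
      refine channelLaw_le_of_forall_update_le ⟨k, hN⟩ ⟨k, hM⟩ hSm fun H => ?_
      obtain ⟨b, hb⟩ := leadingMinor_succ_update hN hM H
      simp only [hS, Set.mem_ofPred_eq, hb, leadingMinor_update hN hM]
      rcases le_or_gt ‖leadingMinor hN' hM' H‖ q with h | h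
      · simp [h.not_gt]
      · simp only [h, and_true]
        refine (complexGaussian_affine_le (norm_pos_iff.1 (hq0.trans h)) b _).trans ?_
        refine ENNReal.ofReal_le_ofReal ?_
        have h1 : q ^ 2 / ‖leadingMinor hN' hM' H‖ ≤ q := by
          rw [div_le_iff₀ (hq0.trans h)]
          nlinarith
        have h2 : 0 ≤ q ^ 2 / ‖leadingMinor hN' hM' H‖ := by positivity
        nlinarith
    calc channelLaw N M {H | ‖leadingMinor hN hM H‖ ≤ r ^ 2 ^ (k + 1)}
        ≤ channelLaw N M ({H | ‖leadingMinor hN' hM' H‖ ≤ q} ∪ S) := by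
          refine measure_mono fun H hH => ?_
          rw [Set.mem_ofPred_eq, hpow] at hH
          rcases le_or_gt ‖leadingMinor hN' hM' H‖ q with h | h
          · exact Or.inl h
          · exact Or.inr ⟨hH, h⟩
      _ ≤ ENNReal.ofReal ((4 * k + 1) * r) + ENNReal.ofReal (4 * r) :=
          (measure_union_le _ _).trans (add_le_add (ih hN' hM') hSle)
      _ = ENNReal.ofReal ((4 * (k + 1 : ℕ) + 1) * r) := by
          rw [← ENNReal.ofReal_add (by positivity) (by positivity)]
          push_cast
          ring_nf

/-! ### Deterministic consequences of a nonzero leading minor -/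

/-- Cramer's rule, quantitatively: a tall matrix with bounded entries, whose top square block has
determinant bounded away from zero, cannot shrink a vector by much. -/
theorem norm_apply_le_of_leadingMinor {N M : ℕ} (hMN : M ≤ N) {H : Fin N → Fin M → ℂ} {t b d : ℝ}
    (ht : 1 ≤ t) (hH : ∀ i j, ‖H i j‖ ≤ t) (hd : 0 < d)
    (hdH : d ≤ ‖leadingMinor hMN le_rfl H‖) {ζ : Fin M → ℂ}
    (hb : ∀ i, ‖(Matrix.of H).mulVec ζ i‖ ≤ b) (j : Fin M) :
    ‖ζ j‖ ≤ M * (M.factorial * t ^ M) * b / d := by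
  set A : Matrix (Fin M) (Fin M) ℂ := Matrix.of fun i j => H (i.castLE hMN) j with hA
  have hdet : leadingMinor hMN le_rfl H = A.det := rfl
  have hadj : ∀ i, ‖A.adjugate j i‖ ≤ M.factorial * t ^ M := by
    intro i
    rw [Matrix.adjugate_apply]
    have := Matrix.det_le (A := A.updateRow i (Pi.single j 1))
      (abv := IsAbsoluteValue.toAbsoluteValue (norm : ℂ → ℝ)) (x := t) ?_
    · simpa using this
    intro i' j'
    change ‖(A.updateRow i (Pi.single j 1)) i' j'‖ ≤ t
    rw [Matrix.updateRow_apply]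
    split_ifs
    · refine le_trans ?_ ht
      rw [Pi.single_apply]
      split_ifs <;> simp
    · exact hH _ _
  have hmul : A.det * ζ j = ∑ i, A.adjugate j i * A.mulVec ζ i := by
    have : A.adjugate.mulVec (A.mulVec ζ) = A.det • ζ := by
      rw [Matrix.mulVec_mulVec, Matrix.adjugate_mul, Matrix.smul_mulVec, Matrix.one_mulVec]
    simpa [Matrix.mulVec, dotProduct] using (congrFun this j).symm
  rw [le_div_iff₀ hd]
  calc ‖ζ j‖ * d ≤ ‖ζ j‖ * ‖A.det‖ := mul_le_mul_of_nonneg_left hdH (norm_nonneg _)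
    _ = ‖∑ i, A.adjugate j i * A.mulVec ζ i‖ := by rw [← hmul, norm_mul, mul_comm]
    _ ≤ ∑ i, ‖A.adjugate j i * A.mulVec ζ i‖ := norm_sum_le _ _
    _ ≤ ∑ _i : Fin M, M.factorial * t ^ M * b := by
        refine Finset.sum_le_sum fun i _ => ?_
        rw [norm_mul]
        exact mul_le_mul (hadj i) (hb (i.castLE hMN)) (norm_nonneg _) (by positivity)
    _ = M * (M.factorial * t ^ M) * b := by simp; ring

/-! ### Gaussian integer vectors -/

/-- A vector of Gaussian integers as a complex vector (with the supremum norm). -/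
noncomputable def gaussianVec {M : ℕ} (z : Fin M → GaussianInt) : Fin M → ℂ :=
  fun j => GaussianInt.toComplex (z j)

theorem gaussianVec_injective {M : ℕ} :
    Function.Injective (gaussianVec : (Fin M → GaussianInt) → Fin M → ℂ) := fun _ _ h =>
  funext fun j => GaussianInt.toComplex_injective (congrFun h j)

/-- The real basis of `ℂ ^ M` whose integral span is `ℤ[i] ^ M`. -/
noncomputable def gaussianBasis (M : ℕ) : Module.Basis (Σ _ : Fin M, Fin 2) ℝ (Fin M → ℂ) :=
  Pi.basis fun _ => Complex.basisOneI

theorem gaussianVec_mem_span {M : ℕ} (z : Fin M → GaussianInt) :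
    gaussianVec z ∈ Submodule.span ℤ (Set.range (gaussianBasis M)) := by
  rw [Module.Basis.mem_span_iff_repr_mem]
  rintro ⟨j, i⟩
  rw [gaussianBasis, Pi.basis_repr, Complex.coe_basisOneI_repr]
  fin_cases i
  · exact ⟨(z j).re, by simp [gaussianVec]⟩
  · exact ⟨(z j).im, by simp [gaussianVec]⟩

theorem finrank_span_gaussianBasis (M : ℕ) :
    Module.finrank ℤ (Submodule.span ℤ (Set.range (gaussianBasis M))) = 2 * M := by
  rw [ZLattice.rank ℝ, Module.finrank_eq_card_basis (gaussianBasis M)]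
  simp [mul_comm]

theorem summable_norm_gaussianVec_rpow {M : ℕ} {r : ℝ} (hr : r < -(2 * M : ℝ)) :
    Summable fun z : Fin M → GaussianInt => ‖gaussianVec z‖ ^ r := by
  have aux : ∀ (L : Submodule ℤ (Fin M → ℂ)) [DiscreteTopology L], Module.finrank ℤ L = 2 * M →
      (∀ z : Fin M → GaussianInt, gaussianVec z ∈ L) →
      Summable fun z : Fin M → GaussianInt => ‖gaussianVec z‖ ^ r := by
    intro L _ hrank hmem
    have h := ZLattice.summable_norm_rpow L r (by rw [hrank]; push_cast; exact hr)
    have hi : Function.Injective fun z : Fin M → GaussianInt => (⟨gaussianVec z, hmem z⟩ : L) :=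
      fun _ _ hz => gaussianVec_injective (congrArg Subtype.val hz)
    have h3 := h.comp_injective hi
    refine h3.congr fun z => ?_
    rfl
  exact aux _ (finrank_span_gaussianBasis M) gaussianVec_mem_span

theorem finite_norm_gaussianVec_le {M : ℕ} (R : ℝ) :
    {z : Fin M → GaussianInt | ‖gaussianVec z‖ ≤ R}.Finite := by
  have hs := summable_norm_gaussianVec_rpow (M := M) (r := -(2 * M + 1)) (by linarith)
  have hR : 0 < (max R 1) ^ (-(2 * M + 1) : ℝ) := by positivity
  have hfin := hs.tendsto_cofinite_zero.eventually (gt_mem_nhds hR)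
  rw [Filter.eventually_cofinite] at hfin
  refine (hfin.union (Set.finite_singleton 0)).subset fun z hz => ?_
  by_cases h0 : z = 0
  · exact Or.inr h0
  refine Or.inl ?_
  have hz0 : 0 < ‖gaussianVec z‖ := norm_pos_iff.2 fun h => h0 <|
    gaussianVec_injective (h.trans (by ext; simp [gaussianVec]))
  rw [Set.mem_ofPred_eq, not_lt]
  exact Real.rpow_le_rpow_of_nonpos hz0 (le_trans hz (le_max_left _ _))
    (by have := M.cast_nonneg (α := ℝ); linarith)

/-! ### Lattice points and decoding -/

theorem latticePoint_eq {N M : ℕ} (κ : ℝ) (H : Fin N → Fin M → ℂ) (x : Fin M → GaussianInt) :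
    latticePoint κ H x = (Matrix.of H).mulVec ((κ : ℂ) • gaussianVec x) := rfl

theorem latticePoint_add {N M : ℕ} (κ : ℝ) (H : Fin N → Fin M → ℂ) (x y : Fin M → GaussianInt) :
    latticePoint κ H (x + y) = latticePoint κ H x + latticePoint κ H y := by
  rw [latticePoint_eq, latticePoint_eq, latticePoint_eq, ← Matrix.mulVec_add, ← smul_add]
  congr 2
  ext j
  simp [gaussianVec]

theorem latticePoint_zero {N M : ℕ} (κ : ℝ) (H : Fin N → Fin M → ℂ) :
    latticePoint κ H 0 = 0 := by
  have h := latticePoint_add κ H 0 0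
  rw [add_zero] at h
  exact left_eq_add.1 h

theorem gaussianVec_ne_zero {M : ℕ} {z : Fin M → GaussianInt} (hz : z ≠ 0) : gaussianVec z ≠ 0 :=
  fun h => hz (gaussianVec_injective (h.trans (by ext; simp [gaussianVec])))

theorem norm_gaussianVec_le {N M : ℕ} (hMN : M ≤ N) {κ : ℝ} (hκ : 0 < κ) {H : Fin N → Fin M → ℂ}
    {t b d : ℝ} (ht : 1 ≤ t) (hH : ∀ i j, ‖H i j‖ ≤ t) (hd : 0 < d)
    (hdH : d ≤ ‖leadingMinor hMN le_rfl H‖) {z : Fin M → GaussianInt}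
    (hb : ‖WithLp.toLp 2 (latticePoint κ H z)‖ ≤ b) :
    ‖gaussianVec z‖ ≤ M * (M.factorial * t ^ M) * b / d / κ := by
  have hb0 : 0 ≤ b := (norm_nonneg _).trans hb
  rw [le_div_iff₀ hκ, mul_comm, ← Real.norm_of_nonneg hκ.le, ← Complex.norm_real, ← norm_smul,
    pi_norm_le_iff_of_nonneg (by positivity)]
  refine norm_apply_le_of_leadingMinor hMN ht hH hd hdH fun i => ?_
  exact (PiLp.norm_apply_le (WithLp.toLp 2 (latticePoint κ H z)) i).trans hb

/-- A channel matrix of full column rank has a nearest lattice point to every received vector. -/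
theorem exists_isNearestLatticePoint {N M : ℕ} (hMN : M ≤ N) {κ : ℝ} (hκ : 0 < κ)
    {H : Fin N → Fin M → ℂ} (hH : leadingMinor hMN le_rfl H ≠ 0) (y : Fin N → ℂ) :
    ∃ z, IsNearestLatticePoint κ H y z := by
  set S := {z : Fin M → GaussianInt |
    ‖WithLp.toLp 2 (y - latticePoint κ H z)‖ ≤ ‖WithLp.toLp 2 y‖} with hS
  have h0 : (0 : Fin M → GaussianInt) ∈ S := by simp [hS, latticePoint_zero]
  have hfin : S.Finite := by
    refine (finite_norm_gaussianVec_le (M * (M.factorial * (1 + ‖H‖) ^ M) *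
      (2 * ‖WithLp.toLp 2 y‖) / ‖leadingMinor hMN le_rfl H‖ / κ)).subset fun z hz => ?_
    refine norm_gaussianVec_le hMN hκ (by linarith [norm_nonneg H]) (fun i j => ?_)
      (norm_pos_iff.2 hH) le_rfl ?_
    · have h1 := norm_le_pi_norm H i
      have h2 := norm_le_pi_norm (H i) j
      linarith
    · have h1 : WithLp.toLp 2 (latticePoint κ H z) =
          WithLp.toLp 2 y - WithLp.toLp 2 (y - latticePoint κ H z) := by
        rw [WithLp.toLp_sub, sub_sub_cancel]
      rw [h1]
      refine (norm_sub_le _ _).trans ?_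
      have h2 : ‖WithLp.toLp 2 (y - latticePoint κ H z)‖ ≤ ‖WithLp.toLp 2 y‖ := hz
      linarith
  obtain ⟨z, hz, hmin⟩ := Set.exists_min_image S
    (fun z => ‖WithLp.toLp 2 (y - latticePoint κ H z)‖) hfin ⟨0, h0⟩
  refine ⟨z, fun z' => ?_⟩
  by_cases h : z' ∈ S
  · exact hmin z' h
  · exact (show _ ≤ _ from hz).trans (not_le.1 h).le

/-! ### Tail bounds -/

theorem exists_noiseLaw_tail_le (N : ℕ) : ∃ C : ℝ, 0 ≤ C ∧ ∀ ρ : ℝ, 1 ≤ ρ → ∀ t : ℝ, 0 < t →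
    noiseLaw N ρ {w | t ≤ ‖WithLp.toLp 2 w‖} ≤ ENNReal.ofReal (C / t) := by
  obtain ⟨C, hC, h⟩ := lintegral_norm_pow_noiseLaw N 1
  refine ⟨C, hC, fun ρ hρ t ht => ?_⟩
  have hm := meas_ge_le_lintegral_div (μ := noiseLaw N ρ)
    (f := fun w => ENNReal.ofReal (‖WithLp.toLp 2 w‖ ^ 1)) (by fun_prop)
    (ε := ENNReal.ofReal t) (by simpa using ht) (by simp)
  calc _ ≤ noiseLaw N ρ {w | ENNReal.ofReal t ≤ ENNReal.ofReal (‖WithLp.toLp 2 w‖ ^ 1)} :=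
        measure_mono fun w hw => ENNReal.ofReal_le_ofReal (by simpa using hw)
    _ ≤ _ := hm
    _ ≤ ENNReal.ofReal C / ENNReal.ofReal t := by
        gcongr
        refine (h ρ (by linarith)).trans (ENNReal.ofReal_le_ofReal ?_)
        rw [pow_one]
        exact mul_le_of_le_one_right hC (inv_le_one_of_one_le₀ (Real.one_le_sqrt.2 hρ))
    _ = _ := (ENNReal.ofReal_div_of_pos ht).symm

theorem exists_channelLaw_tail_le (N M : ℕ) : ∃ C : ℝ, 0 ≤ C ∧ ∀ t : ℝ, 0 < t →
    channelLaw N M {H | ∃ i j, t < ‖H i j‖} ≤ ENNReal.ofReal (C / t) := by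
  obtain ⟨C, hC, h⟩ := exists_noiseLaw_tail_le M
  refine ⟨N * C, by positivity, fun t ht => ?_⟩
  -- A row of the channel matrix is distributed like noise at `ρ = 1` in dimension `M`.
  have hrow : (Measure.pi fun _ : Fin M => complexGaussian 1) = noiseLaw M 1 := by
    simp [noiseLaw]
  calc channelLaw N M {H | ∃ i j, t < ‖H i j‖}
      ≤ channelLaw N M (⋃ i, {H | t ≤ ‖WithLp.toLp 2 (H i)‖}) := by
        refine measure_mono fun H ⟨i, j, hij⟩ => Set.mem_iUnion.2 ⟨i, ?_⟩
        exact hij.le.trans (PiLp.norm_apply_le (WithLp.toLp 2 (H i)) j)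
    _ ≤ ∑ i : Fin N, channelLaw N M {H | t ≤ ‖WithLp.toLp 2 (H i)‖} :=
        measure_iUnion_fintype_le _ _
    _ ≤ ∑ _i : Fin N, ENNReal.ofReal (C / t) := by
        refine Finset.sum_le_sum fun i _ => ?_
        have hmp := measurePreserving_eval
          (fun _ : Fin N => Measure.pi fun _ : Fin M => complexGaussian 1) i
        have hmeas : MeasurableSet {v : Fin M → ℂ | t ≤ ‖WithLp.toLp 2 v‖} :=
          measurableSet_le (by fun_prop) (by fun_prop)
        have := hmp.measure_preimage hmeas.nullMeasurableSet
        rw [hrow] at this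
        refine le_trans (le_of_eq ?_) (h 1 le_rfl t ht)
        rw [← this, channelLaw, hrow]
        rfl
    _ = ENNReal.ofReal (N * C / t) := by
        rw [Finset.sum_const, Finset.card_univ, Fintype.card_fin, nsmul_eq_mul, mul_div_assoc,
          ENNReal.ofReal_mul (by positivity), ENNReal.ofReal_natCast]

/-! ### The pairwise error probability -/

/-- Given the entries of a row outside column `j`, its product with `ζ` is an affine function of the
remaining entry, with slope `ζ j`. -/
theorem row_le {M : ℕ} {ζ : Fin M → ℂ} (j : Fin M) (hj : ζ j ≠ 0) (c : ℂ) (r : ℝ) :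
    (Measure.pi fun _ : Fin M => complexGaussian 1) {h | ‖c - ∑ k, h k * ζ k‖ ≤ r} ≤
      ENNReal.ofReal (4 * (r / ‖ζ j‖) ^ 2) := by
  refine pi_le_of_forall_update_le _ j (measurableSet_le (by fun_prop) (by fun_prop)) fun h => ?_
  refine le_trans (le_of_eq ?_)
    (complexGaussian_affine_le hj (∑ k ∈ Finset.univ.erase j, h k * ζ k - c) r)
  congr 1
  ext x
  have : ∑ k, Function.update h j x k * ζ k = x * ζ j + ∑ k ∈ Finset.univ.erase j, h k * ζ k := by
    rw [← Finset.add_sum_erase _ _ (Finset.mem_univ j), Function.update_self]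
    congr 1
    refine Finset.sum_congr rfl fun k hk => ?_
    rw [Function.update_of_ne (Finset.ne_of_mem_erase hk)]
  rw [Set.mem_ofPred_eq, Set.mem_ofPred_eq, Set.mem_ofPred_eq, this, norm_sub_rev, add_sub_assoc]

/-- For a fixed noise vector `w`, the `N` rows of the channel matrix independently have to put the
coordinates of the lattice point within `‖w‖` of those of `w`. -/
theorem channelLaw_pairwise_le {N M : ℕ} {κ : ℝ} (hκ : 0 < κ) {u : Fin M → GaussianInt}
    (hu : u ≠ 0) (w : Fin N → ℂ) :
    channelLaw N M {H | ‖WithLp.toLp 2 (w - latticePoint κ H u)‖ ≤ ‖WithLp.toLp 2 w‖} ≤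
      ENNReal.ofReal ((4 / (κ * ‖gaussianVec u‖) ^ 2) ^ N) *
        ENNReal.ofReal (‖WithLp.toLp 2 w‖ ^ (2 * N)) := by
  have hv : 0 < ‖gaussianVec u‖ := norm_pos_iff.2 (gaussianVec_ne_zero hu)
  obtain ⟨j, hj⟩ : ∃ j, ‖gaussianVec u‖ ≤ ‖gaussianVec u j‖ := by
    by_contra! h
    exact lt_irrefl _ ((pi_norm_lt_iff hv).2 h)
  set ζ : Fin M → ℂ := (κ : ℂ) • gaussianVec u with hζ
  have hζj : κ * ‖gaussianVec u‖ ≤ ‖ζ j‖ := by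
    rw [hζ, Pi.smul_apply, norm_smul, Complex.norm_real, Real.norm_of_nonneg hκ.le]
    gcongr
  have hζj0 : 0 < κ * ‖gaussianVec u‖ := by positivity
  calc channelLaw N M {H | ‖WithLp.toLp 2 (w - latticePoint κ H u)‖ ≤ ‖WithLp.toLp 2 w‖}
      ≤ channelLaw N M (Set.univ.pi fun i =>
          {h : Fin M → ℂ | ‖w i - ∑ k, h k * ζ k‖ ≤ ‖WithLp.toLp 2 w‖}) := by
        refine measure_mono fun H hH i _ => ?_
        exact (PiLp.norm_apply_le (WithLp.toLp 2 (w - latticePoint κ H u)) i).trans hH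
    _ = ∏ i, (Measure.pi fun _ : Fin M => complexGaussian 1)
          {h : Fin M → ℂ | ‖w i - ∑ k, h k * ζ k‖ ≤ ‖WithLp.toLp 2 w‖} := by
        rw [channelLaw, Measure.pi_pi]
    _ ≤ ∏ _i : Fin N, ENNReal.ofReal (4 / (κ * ‖gaussianVec u‖) ^ 2 * ‖WithLp.toLp 2 w‖ ^ 2) := by
        refine Finset.prod_le_prod' fun i _ => ?_
        refine (row_le j (norm_pos_iff.1 (hζj0.trans_le hζj)) _ _).trans
          (ENNReal.ofReal_le_ofReal ?_)
        rw [div_pow, ← mul_div_assoc, div_mul_eq_mul_div]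
        gcongr
    _ = _ := by
        rw [Finset.prod_const, Finset.card_univ, Fintype.card_fin,
          ← ENNReal.ofReal_pow (by positivity), ← ENNReal.ofReal_mul (by positivity), mul_pow,
          ← pow_mul]

theorem continuous_latticePoint {N M : ℕ} (κ : ℝ) (u : Fin M → GaussianInt) :
    Continuous fun H : Fin N → Fin M → ℂ => latticePoint κ H u := by
  refine continuous_pi fun i => ?_
  have : (fun H : Fin N → Fin M → ℂ => latticePoint κ H u i) =
      fun H => ∑ j, H i j * ((κ : ℂ) * GaussianInt.toComplex (u j)) := rfl
  rw [this]
  fun_prop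

theorem exists_pairwise_le {M : ℕ} (N : ℕ) {κ : ℝ} (hκ : 0 < κ) : ∃ C : ℝ, 0 ≤ C ∧
    ∀ ρ : ℝ, 0 < ρ → ∀ u : Fin M → GaussianInt, u ≠ 0 →
      ((channelLaw N M).prod (noiseLaw N ρ))
        {q | ‖WithLp.toLp 2 (q.2 - latticePoint κ q.1 u)‖ ≤ ‖WithLp.toLp 2 q.2‖} ≤
      ENNReal.ofReal (C * ρ ^ (-N : ℝ) * ‖gaussianVec u‖ ^ (-(2 * N) : ℝ)) := by
  obtain ⟨C, hC, h⟩ := lintegral_norm_pow_noiseLaw N (2 * N)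
  refine ⟨(4 / κ ^ 2) ^ N * C, by positivity, fun ρ hρ u hu => ?_⟩
  have hc := continuous_latticePoint (N := N) κ u
  have hm : MeasurableSet {q : (Fin N → Fin M → ℂ) × (Fin N → ℂ) |
      ‖WithLp.toLp 2 (q.2 - latticePoint κ q.1 u)‖ ≤ ‖WithLp.toLp 2 q.2‖} := by
    refine (isClosed_le ?_ ?_).measurableSet
    · exact ((PiLp.continuous_toLp 2 _).comp
        (continuous_snd.sub (hc.comp continuous_fst))).norm
    · exact ((PiLp.continuous_toLp 2 _).comp continuous_snd).norm
  rw [Measure.prod_apply_symm hm]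
  calc _ ≤ ∫⁻ w, ENNReal.ofReal ((4 / (κ * ‖gaussianVec u‖) ^ 2) ^ N) *
        ENNReal.ofReal (‖WithLp.toLp 2 w‖ ^ (2 * N)) ∂(noiseLaw N ρ) :=
        lintegral_mono fun w => channelLaw_pairwise_le hκ hu w
    _ ≤ ENNReal.ofReal ((4 / (κ * ‖gaussianVec u‖) ^ 2) ^ N) *
        ENNReal.ofReal (C * (√ρ)⁻¹ ^ (2 * N)) := by
        rw [lintegral_const_mul _ (by fun_prop)]
        gcongr
        exact h ρ hρ
    _ = _ := by
        rw [← ENNReal.ofReal_mul (by positivity)]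
        congr 1
        have hcast : (2 * N : ℝ) = ((2 * N : ℕ) : ℝ) := by push_cast; ring
        rw [Real.rpow_neg hρ.le, Real.rpow_neg (norm_nonneg _), Real.rpow_natCast,
          hcast, Real.rpow_natCast, pow_mul, pow_mul, inv_pow,
          Real.sq_sqrt hρ.le, inv_pow, div_pow, div_pow, mul_pow, mul_pow]
        have := norm_pos_iff.2 (gaussianVec_ne_zero hu)
        field_simp

/-! ### The upper bound on the error probability -/

theorem gaussianInt_countable : Countable GaussianInt :=
  (show Function.Injective fun z : GaussianInt => (z.re, z.im) from fun a b h => by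
    rw [Prod.mk.injEq] at h
    exact Zsqrtd.ext h.1 h.2).countable

theorem inputLaw_notMem_eq_zero {M : ℕ} {A : Fin M → Set GaussianInt} {p : Fin M → PMF GaussianInt}
    (hp : ∀ j, (p j).support ⊆ A j) : inputLaw p {x | ∃ j, x j ∉ A j} = 0 := by
  have := fun j => PMF.toMeasure.isProbabilityMeasure (p j)
  rw [show {x : Fin M → GaussianInt | ∃ j, x j ∉ A j} = ⋃ j, {x | x j ∉ A j} by ext; simp,
    measure_iUnion_null_iff]
  intro j
  have hmp := measurePreserving_eval (fun j : Fin M => (p j).toMeasure) j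
  have hm : MeasurableSet (A j)ᶜ := trivial
  have h := hmp.measure_preimage hm.nullMeasurableSet
  rw [(PMF.toMeasure_apply_eq_zero_iff _ hm).2
    (Set.disjoint_compl_right_iff_subset.2 (hp j))] at h
  exact h

/-- A decoding error comes from a nonzero lattice point `u` that is at least as close to the noise
as the origin is, as soon as the channel matrix has full column rank. -/
theorem exists_pairwise_of_error {N M : ℕ} (hMN : M ≤ N) {κ : ℝ} (hκ : 0 < κ)
    {D : (Fin N → Fin M → ℂ) → (Fin N → ℂ) → (Fin M → GaussianInt)} (hD : IsLatticeDecoder κ D)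
    {H : Fin N → Fin M → ℂ} (hH : leadingMinor hMN le_rfl H ≠ 0) {w : Fin N → ℂ}
    {x : Fin M → GaussianInt} (hx : D H (latticePoint κ H x + w) ≠ x) :
    ∃ u : Fin M → GaussianInt, u ≠ 0 ∧
      ‖WithLp.toLp 2 (w - latticePoint κ H u)‖ ≤ ‖WithLp.toLp 2 w‖ := by
  have hn := hD H _ (exists_isNearestLatticePoint hMN hκ hH (latticePoint κ H x + w)) x
  set z := D H (latticePoint κ H x + w)
  refine ⟨z - x, sub_ne_zero.2 hx, ?_⟩
  have hz : latticePoint κ H z = latticePoint κ H (z - x) + latticePoint κ H x := by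
    rw [← latticePoint_add, sub_add_cancel]
  have e1 : latticePoint κ H x + w - latticePoint κ H z = w - latticePoint κ H (z - x) := by
    rw [hz]; abel
  rwa [e1, add_sub_cancel_left] at hn

/-- Union bound over the nonzero integer vectors of norm at most `R`. For `M = N` the sum of the
pairwise bounds over all of `ℤ[i] ^ M` diverges logarithmically; the exponent `η` makes it converge,
at the price of the factor `R ^ η`. -/
theorem exists_sum_pairwise_le {N M : ℕ} (hMN : M ≤ N) {κ : ℝ} (hκ : 0 < κ) {η : ℝ} (hη : 0 < η) :
    ∃ C : ℝ, 0 ≤ C ∧ ∀ ρ : ℝ, 0 < ρ → ∀ R : ℝ,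
      ((channelLaw N M).prod (noiseLaw N ρ))
        {q | ∃ u : Fin M → GaussianInt, u ≠ 0 ∧ ‖gaussianVec u‖ ≤ R ∧
          ‖WithLp.toLp 2 (q.2 - latticePoint κ q.1 u)‖ ≤ ‖WithLp.toLp 2 q.2‖} ≤
      ENNReal.ofReal (C * ρ ^ (-N : ℝ) * R ^ η) := by
  obtain ⟨C, hC, h⟩ := exists_pairwise_le (M := M) N hκ
  have hMN' : (M : ℝ) ≤ N := by exact_mod_cast hMN
  have hs := summable_norm_gaussianVec_rpow (M := M) (r := -(2 * N) - η) (by linarith)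
  refine ⟨C * ∑' u : Fin M → GaussianInt, ‖gaussianVec u‖ ^ (-(2 * N) - η : ℝ),
    mul_nonneg hC (tsum_nonneg fun _ => by positivity), fun ρ hρ R => ?_⟩
  rcases lt_or_ge R 0 with hR | hR
  · have : {q : (Fin N → Fin M → ℂ) × (Fin N → ℂ) | ∃ u : Fin M → GaussianInt, u ≠ 0 ∧
        ‖gaussianVec u‖ ≤ R ∧
        ‖WithLp.toLp 2 (q.2 - latticePoint κ q.1 u)‖ ≤ ‖WithLp.toLp 2 q.2‖} = ∅ := by
      refine Set.eq_empty_iff_forall_notMem.2 fun q ⟨u, _, hu, _⟩ => ?_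
      exact absurd (hR.trans_le (norm_nonneg _)) hu.not_gt
    rw [this]
    simp
  have := gaussianInt_countable
  rw [Set.ofPred_exists]
  calc _ ≤ ∑' u : Fin M → GaussianInt, ENNReal.ofReal
        (C * ρ ^ (-N : ℝ) * R ^ η * ‖gaussianVec u‖ ^ (-(2 * N) - η : ℝ)) := by
        refine (measure_iUnion_le _).trans (ENNReal.tsum_le_tsum fun u => ?_)
        by_cases hu : u ≠ 0 ∧ ‖gaussianVec u‖ ≤ R
        · have hu0 := norm_pos_iff.2 (gaussianVec_ne_zero hu.1)
          refine (measure_mono fun q hq => hq.2.2).trans ((h ρ hρ u hu.1).trans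
            (ENNReal.ofReal_le_ofReal ?_))
          rw [Real.rpow_sub hu0, mul_assoc _ (R ^ η)]
          refine mul_le_mul_of_nonneg_left ?_ (by positivity)
          rw [← mul_div_assoc, le_div_iff₀ (by positivity), mul_comm]
          gcongr
          exact hu.2
        · exact (measure_mono (t := ∅) fun q hq => hu ⟨hq.1, hq.2.1⟩).trans (by simp)
    _ = _ := by
        rw [← ENNReal.ofReal_tsum_of_nonneg (fun _ => by positivity) (hs.mul_left _), tsum_mul_left]
        ring_nf

/-- The error probability is `O(ρ ^ (-N + δ))` for every `δ > 0`. -/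
theorem exists_naiveErrorProb_le {N M : ℕ} (hMN : M ≤ N) {κ : ℝ} (hκ : 0 < κ)
    {A : Fin M → Set GaussianInt} {p : Fin M → PMF GaussianInt} (hp : ∀ j, (p j).support ⊆ A j)
    {D : (Fin N → Fin M → ℂ) → (Fin N → ℂ) → (Fin M → GaussianInt)} (hD : IsLatticeDecoder κ D)
    {δ : ℝ} (hδ : 0 < δ) :
    ∃ C : ℝ, ∀ ρ : ℝ, 1 ≤ ρ → naiveErrorProb κ A p D ρ ≤ C * ρ ^ (-N + δ : ℝ) := by
  -- Outside events of probability `O(ρ ^ (-N))`, an erroneous difference vector has norm at most a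
  -- multiple of `ρ ^ n`, and `η` is so small that `(ρ ^ n) ^ η ≤ ρ ^ δ`.
  set n : ℕ := N * (M + 1 + 2 ^ M) with hn
  set η : ℝ := δ / (n + 1) with hη
  have hη0 : 0 < η := by positivity
  obtain ⟨C₁, hC₁, h₁⟩ := exists_channelLaw_tail_le N M
  obtain ⟨C₂, hC₂, h₂⟩ := exists_noiseLaw_tail_le N
  obtain ⟨C₃, hC₃, h₃⟩ := exists_sum_pairwise_le hMN hκ hη0
  set a : ℝ := M * M.factorial * 2 / κ with ha
  have ha0 : 0 ≤ a := by positivity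
  refine ⟨(4 * M + 1) + C₁ + C₂ + C₃ * a ^ η, fun ρ hρ => ?_⟩
  have hρ0 : 0 < ρ := by linarith
  set t : ℝ := ρ ^ N with ht
  have ht1 : 1 ≤ t := one_le_pow₀ hρ
  have ht0 : 0 < t := by linarith
  have htinv : t⁻¹ = ρ ^ (-N : ℝ) := by rw [Real.rpow_neg hρ0.le, Real.rpow_natCast]
  set R : ℝ := a * ρ ^ n with hR
  set T₁ := {H : Fin N → Fin M → ℂ | ‖leadingMinor hMN le_rfl H‖ ≤ t⁻¹ ^ 2 ^ M} with hT₁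
  set T₂ := {H : Fin N → Fin M → ℂ | ∃ i j, t < ‖H i j‖} with hT₂
  set T₃ := {w : Fin N → ℂ | t ≤ ‖WithLp.toLp 2 w‖} with hT₃
  set T₄ := {q : (Fin N → Fin M → ℂ) × (Fin N → ℂ) | ∃ u : Fin M → GaussianInt, u ≠ 0 ∧
    ‖gaussianVec u‖ ≤ R ∧
      ‖WithLp.toLp 2 (q.2 - latticePoint κ q.1 u)‖ ≤ ‖WithLp.toLp 2 q.2‖} with hT₄
  set T₅ := {x : Fin M → GaussianInt | ∃ j, x j ∉ A j} with hT₅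
  set P := (channelLaw N M).prod ((noiseLaw N ρ).prod (inputLaw p)) with hP
  set E := {s : (Fin N → Fin M → ℂ) × (Fin N → ℂ) × (Fin M → GaussianInt) |
      naiveOutput A D s.1 (latticePoint κ s.1 s.2.2 + s.2.1) ≠ some s.2.2} with hE
  have m₁ : MeasurePreserving Prod.fst P (channelLaw N M) := measurePreserving_fst
  have m₂ : MeasurePreserving Prod.snd P ((noiseLaw N ρ).prod (inputLaw p)) :=
    measurePreserving_snd
  have m₃ : MeasurePreserving (fun s => s.2.1) P (noiseLaw N ρ) := measurePreserving_fst.comp m₂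
  have m₅ : MeasurePreserving (fun s => s.2.2) P (inputLaw p) := measurePreserving_snd.comp m₂
  have m₄ : MeasurePreserving (fun s => (s.1, s.2.1)) P
      ((channelLaw N M).prod (noiseLaw N ρ)) :=
    (MeasurePreserving.id _).prod measurePreserving_fst
  -- `P` is applied as an outer measure: the error event need not be measurable, as the decoder is
  -- arbitrary.
  have hle : ∀ {Y : Type} [MeasurableSpace Y] {f : _ → Y} {ν : Measure Y}
      (_ : MeasurePreserving f P ν) (T : Set Y), P (f ⁻¹' T) ≤ ν T := fun hf T =>
    (Measure.le_map_apply hf.measurable.aemeasurable T).trans_eq (by rw [hf.map_eq])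
  -- `T₁`, `T₂`, `T₃`: an almost singular channel, a large channel entry, large noise; `T₄`: a short
  -- difference vector confuses the decoder; `T₅`: a null event outside the constellations.
  have hsub : E ⊆ Prod.fst ⁻¹' T₁ ∪ Prod.fst ⁻¹' T₂ ∪ (fun s => s.2.1) ⁻¹' T₃ ∪
      (fun s => (s.1, s.2.1)) ⁻¹' T₄ ∪ (fun s => s.2.2) ⁻¹' T₅ := by
    rintro ⟨H, w, x⟩ hs
    by_contra hcon
    simp only [Set.mem_union, Set.mem_preimage, not_or] at hcon
    obtain ⟨⟨⟨⟨c₁, c₂⟩, c₃⟩, c₄⟩, c₅⟩ := hcon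
    have hH : t⁻¹ ^ 2 ^ M < ‖leadingMinor hMN le_rfl H‖ := not_le.1 c₁
    have hd0 : 0 < t⁻¹ ^ 2 ^ M := by positivity
    have hw : ‖WithLp.toLp 2 w‖ < t := not_le.1 c₃
    have hent : ∀ i j, ‖H i j‖ ≤ t := by simpa [hT₂] using c₂
    have hxA : ∀ j, x j ∈ A j := by simpa [hT₅] using c₅
    have hDx : D H (latticePoint κ H x + w) ≠ x := by
      intro h
      refine hs ?_
      simp only [naiveOutput]
      rw [if_pos (by rwa [h]), h]
    obtain ⟨u, hu, huw⟩ := exists_pairwise_of_error hMN hκ hD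
      (norm_pos_iff.1 (hd0.trans hH)) hDx
    refine c₄ ⟨u, hu, ?_, huw⟩
    have hb : ‖WithLp.toLp 2 (latticePoint κ H u)‖ ≤ 2 * t := by
      have h1 : WithLp.toLp 2 (latticePoint κ H u) =
          WithLp.toLp 2 w - WithLp.toLp 2 (w - latticePoint κ H u) := by
        rw [WithLp.toLp_sub, sub_sub_cancel]
      rw [h1]
      refine (norm_sub_le _ _).trans ?_
      linarith
    refine (norm_gaussianVec_le hMN hκ ht1 hent hd0 hH.le hb).trans (le_of_eq ?_)
    rw [hR, ha, hn, pow_mul, ← ht, inv_pow, pow_add, pow_succ]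
    field_simp
  have hrpow : ρ ^ (-N : ℝ) ≤ ρ ^ (-N + δ : ℝ) :=
    Real.rpow_le_rpow_of_exponent_le hρ (by linarith)
  have hRη : ρ ^ (-N : ℝ) * R ^ η ≤ a ^ η * ρ ^ (-N + δ : ℝ) := by
    rw [hR, Real.mul_rpow ha0 (by positivity), ← Real.rpow_natCast ρ n, ← Real.rpow_mul hρ0.le,
      Real.rpow_add hρ0, mul_left_comm]
    have hnη : n * η ≤ δ := by
      rw [hη, ← mul_div_assoc, div_le_iff₀ (by positivity)]
      nlinarith
    gcongr
  have hPE : P E ≤ ENNReal.ofReal (((4 * M + 1) + C₁ + C₂ + C₃ * a ^ η) * ρ ^ (-N + δ : ℝ)) := by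
    calc P E ≤ channelLaw N M T₁ + channelLaw N M T₂ + noiseLaw N ρ T₃ +
          ((channelLaw N M).prod (noiseLaw N ρ)) T₄ + inputLaw p T₅ := by
          refine (measure_mono hsub).trans ?_
          refine (measure_union_le _ _).trans (add_le_add ?_ (hle m₅ T₅))
          refine (measure_union_le _ _).trans (add_le_add ?_ (hle m₄ T₄))
          refine (measure_union_le _ _).trans (add_le_add ?_ (hle m₃ T₃))
          exact (measure_union_le _ _).trans (add_le_add (hle m₁ T₁) (hle m₁ T₂))
      _ ≤ ENNReal.ofReal ((4 * M + 1) * t⁻¹) + ENNReal.ofReal (C₁ / t) + ENNReal.ofReal (C₂ / t) +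
          ENNReal.ofReal (C₃ * ρ ^ (-N : ℝ) * R ^ η) + 0 := by
          gcongr
          · exact channelLaw_leadingMinor_le hMN le_rfl (by positivity) (inv_le_one_of_one_le₀ ht1)
          · exact h₁ t ht0
          · exact h₂ ρ hρ t ht0
          · exact h₃ ρ hρ0 R
          · exact (inputLaw_notMem_eq_zero hp).le
      _ ≤ _ := by
          rw [add_zero, ← ENNReal.ofReal_add (by positivity) (by positivity),
            ← ENNReal.ofReal_add (by positivity) (by positivity),
            ← ENNReal.ofReal_add (by positivity) (by positivity)]
          refine ENNReal.ofReal_le_ofReal ?_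
          rw [div_eq_mul_inv, div_eq_mul_inv, htinv]
          have e1 := mul_le_mul_of_nonneg_left hrpow
            (show 0 ≤ (4 * M + 1 : ℝ) + C₁ + C₂ by positivity)
          have e2 := mul_le_mul_of_nonneg_left hRη hC₃
          linarith
  have hC0 : 0 ≤ ((4 * M + 1) + C₁ + C₂ + C₃ * a ^ η) * ρ ^ (-N + δ : ℝ) := by positivity
  exact (ENNReal.toReal_mono ENNReal.ofReal_ne_top hPE).trans_eq (ENNReal.toReal_ofReal hC0)

/-! ### The lower bound on the error probability -/

/-- If some lattice point is closer to the noise than the origin is, then decoding fails whatever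
vector was sent. -/
theorem naiveOutput_ne_of_lt {N M : ℕ} (hMN : M ≤ N) {κ : ℝ} (hκ : 0 < κ)
    {D : (Fin N → Fin M → ℂ) → (Fin N → ℂ) → (Fin M → GaussianInt)} (hD : IsLatticeDecoder κ D)
    {A : Fin M → Set GaussianInt}
    {H : Fin N → Fin M → ℂ} (hH : leadingMinor hMN le_rfl H ≠ 0) {w : Fin N → ℂ}
    {u : Fin M → GaussianInt}
    (hw : ‖WithLp.toLp 2 (w - latticePoint κ H u)‖ < ‖WithLp.toLp 2 w‖)
    (x : Fin M → GaussianInt) : naiveOutput A D H (latticePoint κ H x + w) ≠ some x := by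
  have hn := hD H _ (exists_isNearestLatticePoint hMN hκ hH (latticePoint κ H x + w))
  intro h
  have hx : D H (latticePoint κ H x + w) = x := by
    unfold naiveOutput at h
    split_ifs at h
    exact Option.some.inj h
  rw [hx] at hn
  have := hn (x + u)
  rw [latticePoint_add, add_sub_cancel_left, add_sub_add_left_eq_sub] at this
  exact this.not_gt hw

/-- The error probability is at least of order `ρ ^ (-N)`. -/
theorem exists_le_naiveErrorProb {N M : ℕ} (hM : 1 ≤ M) (hMN : M ≤ N) {κ : ℝ} (hκ : 0 < κ)
    (A : Fin M → Set GaussianInt) (p : Fin M → PMF GaussianInt)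
    {D : (Fin N → Fin M → ℂ) → (Fin N → ℂ) → (Fin M → GaussianInt)} (hD : IsLatticeDecoder κ D) :
    ∃ c : ℝ, 0 < c ∧ ∀ ρ : ℝ, 1 ≤ ρ → c * ρ ^ (-N : ℝ) ≤ naiveErrorProb κ A p D ρ := by
  -- The first column of the channel matrix and the noise are both of size `1 / √ρ`. After rescaling,
  -- they lie, with the other columns, in a neighbourhood of `(H₀, w₀)`, where the channel has full
  -- rank and the noise is closer to the first lattice generator than to the origin.
  set j₀ : Fin M := ⟨0, hM⟩ with hj₀
  set H₀ : Fin N → Fin M → ℂ := fun i j => if (i : ℕ) = j then 1 else 0 with hH₀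
  set w₀ : Fin N → ℂ := fun i => κ * H₀ i j₀ with hw₀
  set O := {q : (Fin N → Fin M → ℂ) × (Fin N → ℂ) | leadingMinor hMN le_rfl q.1 ≠ 0 ∧
    ‖WithLp.toLp 2 (q.2 - fun i => (κ : ℂ) * q.1 i j₀)‖ < ‖WithLp.toLp 2 q.2‖} with hO
  have hcont₁ : Continuous fun q : (Fin N → Fin M → ℂ) × (Fin N → ℂ) =>
      ‖WithLp.toLp 2 (q.2 - fun i => (κ : ℂ) * q.1 i j₀)‖ :=
    ((PiLp.continuous_toLp 2 fun _ : Fin N => ℂ).comp (continuous_snd.sub (by fun_prop))).norm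
  have hcont₂ : Continuous fun q : (Fin N → Fin M → ℂ) × (Fin N → ℂ) => ‖WithLp.toLp 2 q.2‖ :=
    ((PiLp.continuous_toLp 2 fun _ : Fin N => ℂ).comp continuous_snd).norm
  have hOo : IsOpen O :=
    ((isOpen_compl_singleton (x := (0 : ℂ))).preimage
      ((continuous_leadingMinor hMN le_rfl).comp continuous_fst)).inter (isOpen_lt hcont₁ hcont₂)
  have hmem : (H₀, w₀) ∈ O := by
    refine ⟨?_, ?_⟩
    · have : (Matrix.of fun i j : Fin M => H₀ (i.castLE hMN) (j.castLE le_rfl)) = 1 := by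
        ext i j
        simp [hH₀, Matrix.one_apply, Fin.ext_iff]
      simp only [leadingMinor, this, Matrix.det_one]
      exact one_ne_zero
    · have h1 : w₀ - (fun i => (κ : ℂ) * H₀ i j₀) = 0 := sub_self _
      simp only [h1, WithLp.toLp_zero, norm_zero]
      refine lt_of_lt_of_le hκ ?_
      have := PiLp.norm_apply_le (WithLp.toLp 2 w₀) (j₀.castLE hMN)
      simpa [hw₀, hH₀, hj₀, abs_of_pos hκ] using this
  obtain ⟨ε, hε, hball⟩ := Metric.isOpen_iff.1 hOo _ hmem
  choose k hk0 hk using fun c : ℂ => exists_le_complexGaussian_ball c hε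
  set c₁ : ℝ := ∏ i, ∏ j, k (H₀ i j) with hc₁
  set c₂ : ℝ := ∏ i, k (w₀ i) with hc₂
  have hc₁0 : 0 < c₁ := Finset.prod_pos fun i _ => Finset.prod_pos fun j _ => hk0 _
  have hc₂0 : 0 < c₂ := Finset.prod_pos fun i _ => hk0 _
  refine ⟨c₁ * c₂, by positivity, fun ρ hρ => ?_⟩
  have hρ0 : 0 < ρ := by linarith
  have hsq : 1 ≤ √ρ := Real.one_le_sqrt.2 hρ
  set s : Fin M → ℝ := fun j => if j = j₀ then √ρ else 1 with hs
  have hs1 : ∀ j, 1 ≤ s j := fun j => by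
    simp only [hs]
    split_ifs
    exacts [hsq, le_rfl]
  set T₁ : Set (Fin N → Fin M → ℂ) := Set.univ.pi fun i => Set.univ.pi fun j =>
    {x | ‖(s j : ℂ) * x - H₀ i j‖ < ε} with hT₁
  set T₂ : Set (Fin N → ℂ) := Set.univ.pi fun i => {x | ‖(√ρ : ℂ) * x - w₀ i‖ < ε} with hT₂
  have hch : ENNReal.ofReal (c₁ * ρ ^ (-N : ℝ)) ≤ channelLaw N M T₁ := by
    have hps : ∏ j, s j ^ 2 = ρ := by
      simp only [hs, ite_pow, one_pow]
      rw [Finset.prod_ite_eq' Finset.univ j₀ (fun _ => √ρ ^ 2)]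
      simp [Real.sq_sqrt hρ0.le]
    have hprod : c₁ * ρ ^ (-N : ℝ) = ∏ i, ∏ j, (k (H₀ i j) / s j ^ 2) := by
      simp_rw [Finset.prod_div_distrib, hps]
      rw [Finset.prod_const, Finset.card_univ, Fintype.card_fin, Real.rpow_neg hρ0.le,
        Real.rpow_natCast, div_eq_mul_inv]
    have hnn : ∀ i j, 0 ≤ k (H₀ i j) / s j ^ 2 := fun i j =>
      div_nonneg (hk0 _).le (sq_nonneg _)
    rw [hprod, ENNReal.ofReal_prod_of_nonneg fun i _ => Finset.prod_nonneg fun j _ => hnn i j,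
      channelLaw, hT₁, Measure.pi_pi]
    refine Finset.prod_le_prod' fun i _ => ?_
    rw [ENNReal.ofReal_prod_of_nonneg fun j _ => hnn i j, Measure.pi_pi]
    exact Finset.prod_le_prod' fun j _ => hk _ _ (hs1 j)
  have hno : ENNReal.ofReal c₂ ≤ noiseLaw N ρ T₂ := by
    rw [noiseLaw, hT₂, Measure.pi_pi, hc₂, ENNReal.ofReal_prod_of_nonneg fun i _ => (hk0 _).le]
    refine Finset.prod_le_prod' fun i _ => ?_
    have hm : MeasurableSet {x : ℂ | ‖(√ρ : ℂ) * x - w₀ i‖ < ε} :=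
      measurableSet_lt (by fun_prop) (by fun_prop)
    have h1 := hk (w₀ i) 1 le_rfl
    rw [one_pow, div_one] at h1
    refine h1.trans (le_of_eq ?_)
    have h2 : √(((1 / ρ).toNNReal : NNReal) : ℝ) = (√ρ)⁻¹ := by
      rw [Real.coe_toNNReal _ (by positivity), one_div, Real.sqrt_inv]
    rw [complexGaussian_eq_map (1 / ρ).toNNReal, Measure.map_apply (by fun_prop) hm, h2]
    congr 1
    ext x
    have h3 : (√ρ : ℂ) ≠ 0 := by
      exact_mod_cast (by linarith : √ρ ≠ 0)
    simp [mul_inv_cancel_left₀ h3]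
  have hsub : T₁ ×ˢ (T₂ ×ˢ Set.univ) ⊆
      {s : (Fin N → Fin M → ℂ) × (Fin N → ℂ) × (Fin M → GaussianInt) |
        naiveOutput A D s.1 (latticePoint κ s.1 s.2.2 + s.2.1) ≠ some s.2.2} := by
    rintro ⟨H, w, x⟩ ⟨hH, hw, -⟩
    have hO' : ((fun i j => (s j : ℂ) * H i j, fun i => (√ρ : ℂ) * w i) :
        (Fin N → Fin M → ℂ) × (Fin N → ℂ)) ∈ O := by
      refine hball ?_
      rw [Metric.mem_ball, Prod.dist_eq, max_lt_iff]
      refine ⟨(dist_pi_lt_iff hε).2 fun i => (dist_pi_lt_iff hε).2 fun j => ?_,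
        (dist_pi_lt_iff hε).2 fun i => ?_⟩
      · rw [dist_eq_norm]
        exact hH i trivial j trivial
      · rw [dist_eq_norm]
        exact hw i trivial
    obtain ⟨h1, h2⟩ := hO'
    have hminor : leadingMinor hMN le_rfl H ≠ 0 := by
      have := Matrix.det_mul_row (fun j => (s j : ℂ))
        (Matrix.of fun i j : Fin M => H (i.castLE hMN) (j.castLE le_rfl))
      intro h0
      refine h1 (this.trans ?_)
      rw [show (Matrix.of fun i j : Fin M => H (i.castLE hMN) (j.castLE le_rfl)).det = 0 from h0,
        mul_zero]
    refine naiveOutput_ne_of_lt hMN hκ hD hminor (u := Pi.single j₀ 1) ?_ x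
    have hlp : latticePoint κ H (Pi.single j₀ 1) = fun i => (κ : ℂ) * H i j₀ := by
      have : ((κ : ℂ) • gaussianVec (Pi.single j₀ 1 : Fin M → GaussianInt)) =
          Pi.single j₀ (κ : ℂ) := by
        ext j
        by_cases hj : j = j₀
        · subst hj; simp [gaussianVec]
        · simp [gaussianVec, hj]
      rw [latticePoint_eq, this]
      ext i
      simp [mul_comm]
    have e1 : WithLp.toLp 2 ((fun i => (√ρ : ℂ) * w i) -
        fun i => (κ : ℂ) * ((s j₀ : ℂ) * H i j₀)) =
        (√ρ : ℂ) • WithLp.toLp 2 (w - latticePoint κ H (Pi.single j₀ 1)) := by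
      rw [hlp]
      ext i
      simp [hs]
      ring
    have e2 : WithLp.toLp 2 (fun i => (√ρ : ℂ) * w i) = (√ρ : ℂ) • WithLp.toLp 2 w := rfl
    simp only [e1, e2, norm_smul] at h2
    exact lt_of_mul_lt_mul_left h2 (norm_nonneg _)
  have hP : ENNReal.ofReal (c₁ * c₂ * ρ ^ (-N : ℝ)) ≤
      ((channelLaw N M).prod ((noiseLaw N ρ).prod (inputLaw p)))
      {s : (Fin N → Fin M → ℂ) × (Fin N → ℂ) × (Fin M → GaussianInt) |
        naiveOutput A D s.1 (latticePoint κ s.1 s.2.2 + s.2.1) ≠ some s.2.2} := by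
    refine le_trans ?_ (measure_mono hsub)
    rw [Measure.prod_prod, Measure.prod_prod, measure_univ, mul_one, mul_right_comm,
      ENNReal.ofReal_mul (by positivity)]
    exact mul_le_mul' hch hno
  exact (ENNReal.ofReal_le_iff_le_toReal (measure_ne_top _ _)).1 hP

/-! ### The diversity order -/

/-- A function squeezed between `c ρ ^ (-d)` and `C ρ ^ (-d + δ)` for every `δ > 0` decays with
exponent exactly `d`. -/
theorem tendsto_neg_log_div_log {f : ℝ → ℝ} {d : ℝ}
    (hl : ∃ c : ℝ, 0 < c ∧ ∀ ρ : ℝ, 1 ≤ ρ → c * ρ ^ (-d) ≤ f ρ)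
    (hu : ∀ δ : ℝ, 0 < δ → ∃ C : ℝ, ∀ ρ : ℝ, 1 ≤ ρ → f ρ ≤ C * ρ ^ (-d + δ)) :
    Tendsto (fun ρ : ℝ => -Real.log (f ρ) / Real.log ρ) atTop (𝓝 d) := by
  obtain ⟨c, hc, hcf⟩ := hl
  have hf0 : ∀ ρ, 1 ≤ ρ → 0 < f ρ := fun ρ hρ =>
    (by have : 0 < ρ := by linarith
        positivity : 0 < c * ρ ^ (-d)).trans_le (hcf ρ hρ)
  refine tendsto_order.2 ⟨fun a ha => ?_, fun a ha => ?_⟩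
  · obtain ⟨C, hC⟩ := hu ((d - a) / 2) (by linarith)
    have hC0 : 0 < C := by simpa using (hf0 1 le_rfl).trans_le (hC 1 le_rfl)
    filter_upwards [eventually_gt_atTop 1,
      Real.tendsto_log_atTop.eventually_gt_atTop (Real.log C / ((d - a) / 2))] with ρ hρ hlog
    have hL := Real.log_pos hρ
    have hρ0 : 0 < ρ := by linarith
    rw [lt_div_iff₀ hL]
    rw [div_lt_iff₀ (by linarith)] at hlog
    have h := Real.log_le_log (hf0 ρ hρ.le) (hC ρ hρ.le)
    rw [Real.log_mul hC0.ne' (by positivity), Real.log_rpow hρ0] at h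
    nlinarith
  · filter_upwards [eventually_gt_atTop 1,
      Real.tendsto_log_atTop.eventually_gt_atTop (-Real.log c / (a - d))] with ρ hρ hlog
    have hL := Real.log_pos hρ
    have hρ0 : 0 < ρ := by linarith
    rw [div_lt_iff₀ hL]
    rw [div_lt_iff₀ (by linarith)] at hlog
    have h := Real.log_le_log (by positivity) (hcf ρ hρ.le)
    rw [Real.log_mul hc.ne' (by positivity), Real.log_rpow hρ0] at h
    nlinarith

theorem theorem3 (N M : ℕ) (hM : 1 ≤ M) (hMN : M ≤ N)
    (κ : ℝ) (hκ : 0 < κ)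
    (A : Fin M → Set GaussianInt) (p : Fin M → PMF GaussianInt) (hp : ∀ j, (p j).support ⊆ A j)
    (D : (Fin N → Fin M → ℂ) → (Fin N → ℂ) → (Fin M → GaussianInt)) (hD : IsLatticeDecoder κ D) :
    Tendsto (fun ρ : ℝ => -Real.log (naiveErrorProb κ A p D ρ) / Real.log ρ) atTop
      (𝓝 (N : ℝ)) :=
  tendsto_neg_log_div_log (exists_le_naiveErrorProb hM hMN hκ A p hD)
    fun _ hδ => exists_naiveErrorProb_le hMN hκ hp hD hδ
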